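/- Consider a trial-offer market with $N$ items, $N$ positions of visibilities $v_1\ge v_2\ge\dots\ge v_N>0$, and $K$ consumer classes with weights $w_k>0$, $\sum_k w_k=1$; item $i$ has appeal $a_{i,k}\ge 0$ and quality $q_{i,k}\in[0,1]$ for class $k$. Consumers arrive one at a time, each belonging to class $k$ with probability $w_k$. If the ranking is the permutation $\sigma$ (item $i$ stands in position $\sigma(i)$) and the displayed popularity vector is $d\in\mathbb N^N$, a consumer of class $k$ tries item $i$ with probability $$p_{i,k}(\sigma,d)=\frac{v_{\sigma(i)}(a_{i,k}+d_i)}{\sum_{j} v_{\sigma(j)}(a_{j,k}+d_j)+z},\qquad z\ge 0,$$ and then buys it with probability $q_{i,k}$. Let $\bar q_i=\sum_k w_kq_{i,k}$, and let $\sigma$ be an average quality ranking, that is, a static ranking by decreasing $\bar q_i$ (ties in any order). With the popularity signal, $d$ is the vector of past purchases, initially $0$; let $P_{AQGSI}$ be the limit, as $t\to\infty$, of the probability that the $t$-th consumer makes a purchase. Without the signal $d$ is replaced by $0$, and the purchase probability is $P_{AQNSI}=\sum_k w_k\sum_i p_{i,k}(\sigma,0)\,q_{i,k}$. Proposition. The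 bounds $0$ and $K$ in $0\le P_{AQNSI}/P_{AQGSI}\le K$ are tight. Precisely, let $K=N\ge 1$, $z=0$, $w_k=1/K$ for all $k$, let $v_1\ge\dots\ge v_K>0$ be arbitrary, and for $0<\epsilon<1$ let the quality matrix be diagonal with first diagonal entry $1$ and all other diagonal entries $1-\epsilon$. 1. If the appeal matrix is the identity, then for every $\epsilon\in(0,1)$ and every average quality ranking the limit $P_{AQGSI}$ exists, is positive and equals $\max_i\bar q_i$, and for every choice of average quality rankings $$\lim_{\epsilon\to0^+}\frac{P_{AQNSI}}{P_{AQGSI}}=K.$$ The value $K$ is also approached by strictly positive appeals: for every $r<K$ there are $\epsilon\in(0,1)$ and a matrix of strictly positive appeals such that, for every average quality ranking, the limit $P_{AQGSI}$ exists, is positive and equals $\max_i\bar q_i$, and $P_{AQNSI}/P_{AQGSI}>r$. 2. If $K\ge2$, $\epsilon\in(0,1)$ is fixed, and the appeal matrix has all diagonal entries equal to $\epsilon_A>0$ and all other entries equal to $1$, then for every $\epsilon_A>0$ and every average quality ranking the limit $P_{AQGSI}$ exists, is positive and equals $\max_i\bar q_i$, and for every choice of average quality rankings $$\lim_{\epsilon_A\to0^+}\frac{P_{AQNSI}}{P_{AQGSI}}=0.$$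 -/

import Mathlib

open Filter Topology

/-- The parameters of a trial-offer market with `N` items (equivalently `N` positions) and `K`
consumer classes: visibilities `v j` of the positions, appeals `a i k` and qualities `q i k` of
item `i` for class `k`, class weights `w k` (the probability that an arriving consumer belongs to
class `k`), and the constant `z` of the no-trial option. -/
structure Market (N K : ℕ) where
  v : Fin N → ℝ
  a : Fin N → Fin K → ℝ
  q : Fin N → Fin K → ℝ
  w : Fin K → ℝ
  z : ℝ

namespace Market

variable {N K : ℕ}

/-- The parameters form a mixed multinomial logit model. Positions are sorted by visibility.
Appeals are allowed to vanish here; strict positivity is `PositiveAppeals`. -/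
structure IsMMNL (M : Market N K) : Prop where
  v_nonneg : ∀ j, 0 ≤ M.v j
  v_antitone : Antitone M.v
  a_nonneg : ∀ i k, 0 ≤ M.a i k
  q_nonneg : ∀ i k, 0 ≤ M.q i k
  q_le_one : ∀ i k, M.q i k ≤ 1
  w_pos : ∀ k, 0 < M.w k
  w_sum : ∑ k, M.w k = 1
  z_nonneg : 0 ≤ M.z

/-- All appeals are strictly positive. -/
def PositiveAppeals (M : Market N K) : Prop := ∀ i k, 0 < M.a i k

/-- The probability that a consumer of class `k` tries item `i` when item `j` stands in position
`σ j` and the displayed popularity vector is `d`. -/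
noncomputable def tryProb (M : Market N K) (σ : Equiv.Perm (Fin N)) (d : Fin N → ℕ)
    (i : Fin N) (k : Fin K) : ℝ :=
  M.v (σ i) * (M.a i k + d i) / (∑ j, M.v (σ j) * (M.a j k + d j) + M.z)

/-- The probability that the next consumer, of a random class, buys item `i` when the displayed
popularity vector is `d`. -/
noncomputable def buyProb (M : Market N K) (σ : Equiv.Perm (Fin N)) (d : Fin N → ℕ)
    (i : Fin N) : ℝ :=
  ∑ k, M.w k * (M.tryProb σ d i k * M.q i k)

theorem tryProb_nonneg {M : Market N K} (h : M.IsMMNL) (σ : Equiv.Perm (Fin N))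
    (d : Fin N → ℕ) (i : Fin N) (k : Fin K) : 0 ≤ M.tryProb σ d i k := by
  have key : ∀ j, 0 ≤ M.v (σ j) * (M.a j k + d j) := fun j =>
    mul_nonneg (h.v_nonneg _) (add_nonneg (h.a_nonneg _ _) (Nat.cast_nonneg _))
  exact div_nonneg (key i) (add_nonneg (Finset.sum_nonneg fun j _ => key j) h.z_nonneg)

theorem sum_tryProb_le_one {M : Market N K} (h : M.IsMMNL) (σ : Equiv.Perm (Fin N))
    (d : Fin N → ℕ) (k : Fin K) : ∑ i, M.tryProb σ d i k ≤ 1 := by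
  have key : ∀ j, 0 ≤ M.v (σ j) * (M.a j k + d j) := fun j =>
    mul_nonneg (h.v_nonneg _) (add_nonneg (h.a_nonneg _ _) (Nat.cast_nonneg _))
  have hs := Finset.sum_nonneg fun j (_ : j ∈ Finset.univ) => key j
  simp only [tryProb]
  rw [← Finset.sum_div]
  exact div_le_one_of_le₀ (by linarith [h.z_nonneg]) (add_nonneg hs h.z_nonneg)

theorem buyProb_nonneg {M : Market N K} (h : M.IsMMNL) (σ : Equiv.Perm (Fin N))
    (d : Fin N → ℕ) (i : Fin N) : 0 ≤ M.buyProb σ d i :=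
  Finset.sum_nonneg fun k _ => mul_nonneg (h.w_pos k).le
    (mul_nonneg (tryProb_nonneg h σ d i k) (h.q_nonneg i k))

theorem sum_buyProb_le_one {M : Market N K} (h : M.IsMMNL) (σ : Equiv.Perm (Fin N))
    (d : Fin N → ℕ) : ∑ i, M.buyProb σ d i ≤ 1 := by
  simp only [buyProb]
  rw [Finset.sum_comm, ← h.w_sum]
  refine Finset.sum_le_sum fun k _ => ?_
  rw [← Finset.mul_sum]
  refine mul_le_of_le_one_right (h.w_pos k).le (le_trans (Finset.sum_le_sum fun i _ => ?_)
    (sum_tryProb_le_one h σ d k))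
  exact mul_le_of_le_one_right (tryProb_nonneg h σ d i k) (h.q_le_one i k)

/-- The law of the decision of the next consumer when the displayed popularity vector is `d`:
`some i` means that item `i` is bought, `none` that nothing is bought. -/
noncomputable def outcome (M : Market N K) (h : M.IsMMNL) (σ : Equiv.Perm (Fin N))
    (d : Fin N → ℕ) : PMF (Option (Fin N)) :=
  PMF.ofFintype
    (fun o => ENNReal.ofReal (o.elim (1 - ∑ i, M.buyProb σ d i) fun i => M.buyProb σ d i))
    (by
      rw [Fintype.sum_option, Option.elim_none]
      simp only [Option.elim_some]
      rw [← ENNReal.ofReal_sum_of_nonneg fun i _ => buyProb_nonneg h σ d i,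
        ← ENNReal.ofReal_add (sub_nonneg.2 (sum_buyProb_le_one h σ d))
          (Finset.sum_nonneg fun i _ => buyProb_nonneg h σ d i)]
      simp)

/-- The law of the sales vector after `t` consumers when the ranking `σ` is always used and every
consumer is shown the current sales vector. Sales start from zero. -/
noncomputable def sales (M : Market N K) (h : M.IsMMNL) (σ : Equiv.Perm (Fin N)) :
    ℕ → PMF (Fin N → ℕ)
  | 0 => PMF.pure 0
  | t + 1 => (M.sales h σ t).bind fun d =>
      (M.outcome h σ d).map fun o => o.elim d fun i => d + Pi.single i 1

/-- The probability that the consumer who arrives after `t` others buys an item, when the ranking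
`σ` is always used and the popularity signal is shown. -/
noncomputable def signalPurchaseProb (M : Market N K) (h : M.IsMMNL) (σ : Equiv.Perm (Fin N))
    (t : ℕ) : ℝ :=
  ∑ i, (((M.sales h σ t).bind (M.outcome h σ)) (some i)).toReal

/-- The probability that a consumer buys an item when the popularity signal is not used, that is,
when the popularity vector is replaced by zero. -/
noncomputable def noSignalPurchaseProb (M : Market N K) (σ : Equiv.Perm (Fin N)) : ℝ :=
  ∑ i, M.buyProb σ 0 i

/-- The weighted average quality of item `i`. -/
noncomputable def avgQuality (M : Market N K) (i : Fin N) : ℝ := ∑ k, M.w k * M.q i k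

/-- The highest weighted average quality of an item. -/
noncomputable def maxAvgQuality (M : Market N K) : ℝ := ⨆ i, M.avgQuality i

/-- `σ` lists the items in decreasing order of weighted average quality (ties in any order). -/
def IsAvgQualityRanking (M : Market N K) (σ : Equiv.Perm (Fin N)) : Prop :=
  ∀ i j, σ i < σ j → M.avgQuality j ≤ M.avgQuality i

/-- `L` is the limiting purchase probability of the static ranking `σ` with the
popularity signal. -/
def HasSignalLimit (M : Market N K) (h : M.IsMMNL) (σ : Equiv.Perm (Fin N)) (L : ℝ) : Prop :=
  Tendsto (fun t => M.signalPurchaseProb h σ t) atTop (𝓝 L)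

/-- The market with `K` items and `K` classes, visibilities `v`, appeals `a`, equal weights,
`z = 0`, and the diagonal quality matrix with first entry `1` and other entries `1 - ε`. -/
noncomputable def diagonal (v : Fin K → ℝ) (ε : ℝ) (a : Fin K → Fin K → ℝ) : Market K K where
  v := v
  a := a
  q := fun i k => if i = k then (if i.val = 0 then 1 else 1 - ε) else 0
  w := fun _ => 1 / (K : ℝ)
  z := 0

/-- The identity appeal matrix. -/
def idAppeal (K : ℕ) : Fin K → Fin K → ℝ := fun i k => if i = k then 1 else 0

/-- The appeal matrix with diagonal entries `α` and all other entries `1`. -/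
def smallDiagAppeal (K : ℕ) (α : ℝ) : Fin K → Fin K → ℝ := fun i k => if i = k then α else 1

end Market

/-! Item `i` is bought only by class `i`, so each purchase probability has a single term. Let `o` be
the item with index 0. It has strictly the highest average quality, hence a position at least as
visible as any other.

With the signal, `o` ends up monopolizing the sales, so that only class `o` buys and the purchase
probability tends to `1 / K`. For a rival `j` put `x = d j + α`, `y = d o + α`. Apart from a common
factor, `x` grows at relative rate at most `1 - ε` times that of `y`, so for `τ = (1 - ε) * s` the
quantity `x ^ s / y ^ τ` is nearly a supermartingale; replacing `y ^ (-τ)` by `Γ(y - τ) / Γ(y)`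
makes it an exact one (`transition_powerRatio_le`). With `n` total sales plus `α`, the share `x / n`
is at most this quantity times `n ^ (τ - s)`, and `τ < s` makes the factor small once `n` is large.
Few sales are unlikely, because purchase probabilities are bounded below and so `(1 / 2) ^ sales`
contracts in mean. `hasSignalLimit_of_lyapunov` combines both facts: only expectations are needed,
no almost sure convergence.

Without the signal, dividing by `1 / K` leaves an explicit sum over the items
(`noSignalPurchaseProb_div_maxAvgQuality`). Identity appeals send each class to the item it likes,
and every term tends to 1; small diagonal appeals send it elsewhere, and every term tends to 0. -/

namespace Market

variable {N K : ℕ}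

/-! ### Expectations of the sales process and the Lyapunov criterion -/

/-- The one-step expectation operator of the sales process: `transition M σ φ d` is the expected
value of `φ` after one more consumer has been shown the popularity vector `d`. -/
noncomputable def transition (M : Market N K) (σ : Equiv.Perm (Fin N)) :
    ((Fin N → ℕ) → ℝ) →ₗ[ℝ] ((Fin N → ℕ) → ℝ) where
  toFun φ d := φ d + ∑ i, M.buyProb σ d i * (φ (d + Pi.single i 1) - φ d)
  map_add' φ ψ := by
    funext d
    simp only [Pi.add_apply, add_sub_add_comm, mul_add, Finset.sum_add_distrib]
    ring
  map_smul' c φ := by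
    funext d
    simp only [Pi.smul_apply, smul_eq_mul, RingHom.id_apply, mul_add, Finset.mul_sum]
    congr 1
    exact Finset.sum_congr rfl fun i _ => by ring

theorem transition_apply (M : Market N K) (σ : Equiv.Perm (Fin N)) (φ : (Fin N → ℕ) → ℝ)
    (d : Fin N → ℕ) :
    M.transition σ φ d = φ d + ∑ i, M.buyProb σ d i * (φ (d + Pi.single i 1) - φ d) := rfl

theorem transition_apply' (M : Market N K) (σ : Equiv.Perm (Fin N)) (φ : (Fin N → ℕ) → ℝ)
    (d : Fin N → ℕ) :
    M.transition σ φ d = (1 - ∑ i, M.buyProb σ d i) * φ d +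
      ∑ i, M.buyProb σ d i * φ (d + Pi.single i 1) := by
  rw [transition_apply]
  simp only [mul_sub, Finset.sum_sub_distrib, ← Finset.sum_mul]
  ring

theorem transition_mono {M : Market N K} (h : M.IsMMNL) (σ : Equiv.Perm (Fin N)) :
    Monotone (M.transition σ) := by
  intro φ ψ hφ d
  rw [transition_apply', transition_apply']
  exact add_le_add (mul_le_mul_of_nonneg_left (hφ d) (sub_nonneg.2 (sum_buyProb_le_one h σ d)))
    (Finset.sum_le_sum fun i _ => mul_le_mul_of_nonneg_left (hφ _) (buyProb_nonneg h σ d i))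

theorem transition_pow_mono {M : Market N K} (h : M.IsMMNL) (σ : Equiv.Perm (Fin N)) (t : ℕ) :
    Monotone (M.transition σ ^ t : Module.End ℝ ((Fin N → ℕ) → ℝ)) := by
  rw [Module.End.coe_pow]
  exact (transition_mono h σ).iterate t

theorem transition_const (M : Market N K) (σ : Equiv.Perm (Fin N)) (c : ℝ) :
    M.transition σ (fun _ => c) = fun _ => c := by
  funext d
  simp [transition_apply]

theorem transition_pow_const (M : Market N K) (σ : Equiv.Perm (Fin N)) (c : ℝ) (t : ℕ) :
    (M.transition σ ^ t) (fun _ => c) = fun _ => c := by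
  induction t with
  | zero => rfl
  | succ t ih => rw [pow_succ, Module.End.mul_apply, transition_const, ih]

/-- A function that the transition operator contracts by the factor `r` decays geometrically. -/
theorem transition_pow_le_of_transition_le {M : Market N K} (h : M.IsMMNL)
    (σ : Equiv.Perm (Fin N)) {φ : (Fin N → ℕ) → ℝ} {r : ℝ} (hr : 0 ≤ r)
    (hφ : M.transition σ φ ≤ r • φ) (t : ℕ) : (M.transition σ ^ t) φ ≤ r ^ t • φ := by
  induction t with
  | zero => simp
  | succ t ih =>
    rw [pow_succ, Module.End.mul_apply]
    calc (M.transition σ ^ t) (M.transition σ φ) ≤ (M.transition σ ^ t) (r • φ) :=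
          transition_pow_mono h σ t hφ
      _ = r • (M.transition σ ^ t) φ := map_smul _ _ _
      _ ≤ r • (r ^ t • φ) := smul_le_smul_of_nonneg_left ih hr
      _ = r ^ (t + 1) • φ := by rw [smul_smul, pow_succ']

theorem transition_pow_nonneg {M : Market N K} (h : M.IsMMNL) (σ : Equiv.Perm (Fin N))
    {φ : (Fin N → ℕ) → ℝ} (hφ : 0 ≤ φ) (t : ℕ) : 0 ≤ (M.transition σ ^ t) φ := by
  simpa using transition_pow_mono h σ t hφ

theorem _root_.PMF.tsum_bind_mul {α β : Type*} (p : PMF α) (f : α → PMF β) (g : β → ENNReal) :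
    ∑' b, p.bind f b * g b = ∑' a, p a * ∑' b, f a b * g b := by
  simp only [PMF.bind_apply, ← ENNReal.tsum_mul_right, ← ENNReal.tsum_mul_left]
  rw [ENNReal.tsum_comm]
  simp only [mul_assoc]

theorem _root_.PMF.tsum_pure_mul {α : Type*} (a : α) (g : α → ENNReal) :
    ∑' b, PMF.pure a b * g b = g a := by
  rw [tsum_eq_single a]
  · simp
  · intro b hb
    simp [PMF.pure_apply, hb]

theorem _root_.PMF.tsum_map_mul {α β : Type*} (p : PMF α) (f : α → β) (g : β → ENNReal) :
    ∑' b, p.map f b * g b = ∑' a, p a * g (f a) := by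
  rw [← PMF.bind_pure_comp, PMF.tsum_bind_mul]
  simp only [Function.comp_apply, PMF.tsum_pure_mul]

/-- The Markov property, with the last step of the chain absorbed into the test function. This turns
expectations under the law of sales into iterates of a monotone linear operator, evaluated at the
zero sales vector. -/
theorem tsum_sales_mul {M : Market N K} (h : M.IsMMNL) (σ : Equiv.Perm (Fin N)) (t : ℕ)
    (φ : (Fin N → ℕ) → ℝ) (hφ : 0 ≤ φ) :
    ∑' d, M.sales h σ t d * ENNReal.ofReal (φ d) =
      ENNReal.ofReal ((M.transition σ ^ t) φ 0) := by
  induction t generalizing φ with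
  | zero => simp [sales]
  | succ t ih =>
    rw [pow_succ, Module.End.mul_apply, ← ih _ (by simpa using transition_mono h σ hφ), sales,
      PMF.tsum_bind_mul]
    refine tsum_congr fun d => ?_
    congr 1
    rw [PMF.tsum_map_mul, tsum_fintype, Fintype.sum_option, transition_apply']
    have hp := buyProb_nonneg h σ d
    have hs := sub_nonneg.2 (sum_buyProb_le_one h σ d)
    rw [ENNReal.ofReal_add (mul_nonneg hs (hφ d))
      (Finset.sum_nonneg fun i _ => mul_nonneg (hp i) (hφ _)), ENNReal.ofReal_mul hs,
      ENNReal.ofReal_sum_of_nonneg fun i _ => mul_nonneg (hp i) (hφ _)]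
    simp only [outcome, PMF.ofFintype_apply, Option.elim_none, Option.elim_some]
    congr 1
    exact Finset.sum_congr rfl fun i _ => (ENNReal.ofReal_mul (hp i)).symm

theorem signalPurchaseProb_eq {M : Market N K} (h : M.IsMMNL) (σ : Equiv.Perm (Fin N)) (t : ℕ) :
    M.signalPurchaseProb h σ t = (M.transition σ ^ t) (fun d => ∑ i, M.buyProb σ d i) 0 := by
  have hf : (fun d => ∑ i, M.buyProb σ d i) = ∑ i, fun d => M.buyProb σ d i := by
    funext d
    simp
  rw [hf, map_sum, Finset.sum_apply, signalPurchaseProb]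
  refine Finset.sum_congr rfl fun i _ => ?_
  have hp : (0 : (Fin N → ℕ) → ℝ) ≤ fun d => M.buyProb σ d i := fun d => buyProb_nonneg h σ d i
  have key := tsum_sales_mul h σ t _ hp
  rw [PMF.bind_apply]
  simp only [outcome, PMF.ofFintype_apply, Option.elim_some]
  rw [key, ENNReal.toReal_ofReal (transition_pow_nonneg h σ hp t 0)]

/-- Lyapunov criterion: the purchase probability tends to `L` if its distance to `L` is controlled
by an arbitrarily small multiple of a supermartingale and a multiple of a contracted function. -/
theorem hasSignalLimit_of_lyapunov {M : Market N K} (h : M.IsMMNL) (σ : Equiv.Perm (Fin N))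
    {L r : ℝ} {Φ G : (Fin N → ℕ) → ℝ} (hr0 : 0 ≤ r) (hr1 : r < 1)
    (hΦ0 : 0 ≤ Φ 0) (hΦ : M.transition σ Φ ≤ Φ) (hG : M.transition σ G ≤ r • G)
    (hf : ∀ η : ℝ, 0 < η → ∃ C : ℝ, 0 ≤ C ∧
      ∀ d, |∑ i, M.buyProb σ d i - L| ≤ η * Φ d + C * G d) :
    M.HasSignalLimit h σ L := by
  have hbound : ∀ η : ℝ, 0 < η → ∃ C : ℝ, 0 ≤ C ∧
      ∀ t, |M.signalPurchaseProb h σ t - L| ≤ η * Φ 0 + C * (r ^ t * G 0) := by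
    intro η hη
    obtain ⟨C, hC, hfC⟩ := hf η hη
    refine ⟨C, hC, fun t => ?_⟩
    have hB : (M.transition σ ^ t) (η • Φ + C • G) 0 ≤ η * Φ 0 + C * (r ^ t * G 0) := by
      have h1 := transition_pow_le_of_transition_le h σ (φ := Φ) (r := 1) zero_le_one
        (by simpa using hΦ) t 0
      have h2 := transition_pow_le_of_transition_le h σ hr0 hG t 0
      rw [map_add, map_smul, map_smul]
      simp only [Pi.add_apply, Pi.smul_apply, smul_eq_mul, one_pow, one_mul] at h1 h2 ⊢
      gcongr
    have hsub : (M.transition σ ^ t) ((fun d => ∑ i, M.buyProb σ d i) - fun _ => L) 0 =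
        M.signalPurchaseProb h σ t - L := by
      rw [map_sub, transition_pow_const, signalPurchaseProb_eq]
      rfl
    rw [← hsub, abs_le]
    constructor
    · have := transition_pow_mono h σ t (a := -(η • Φ + C • G))
        (b := (fun d => ∑ i, M.buyProb σ d i) - fun _ => L) (fun d => (abs_le.1 (hfC d)).1) 0
      rw [map_neg] at this
      simp only [Pi.neg_apply] at this
      linarith
    · exact (transition_pow_mono h σ t (b := η • Φ + C • G)
        (fun d => (abs_le.1 (hfC d)).2) 0).trans hB
  rw [HasSignalLimit, Metric.tendsto_atTop']
  intro δ hδ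
  -- This `η` gives the supermartingale half of `δ`; the `+ 1` covers the case `Φ 0 = 0`.
  obtain ⟨C, hC, hb⟩ := hbound (δ / (2 * (Φ 0 + 1))) (by positivity)
  have ht : Tendsto (fun t : ℕ => C * (r ^ t * G 0)) atTop (𝓝 0) := by
    simpa using ((tendsto_pow_atTop_nhds_zero_of_lt_one hr0 hr1).mul_const (G 0)).const_mul C
  obtain ⟨T, hT⟩ := eventually_atTop.1 (ht.eventually_lt_const (half_pos hδ))
  refine ⟨T, fun t htT => ?_⟩
  rw [Real.dist_eq]
  have h1 : δ / (2 * (Φ 0 + 1)) * Φ 0 ≤ δ / 2 := by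
    rw [div_mul_eq_mul_div, div_le_div_iff₀ (by positivity) two_pos]
    nlinarith
  linarith [hb t, hT t htT.le]

/-! ### Diagonal markets, with both families of appeals treated at once -/

/-- The appeal matrix with diagonal entries `α` and all other entries `β`. -/
def diagAppeal (K : ℕ) (α β : ℝ) : Fin K → Fin K → ℝ := fun i k => if i = k then α else β

theorem isMMNL_diagonal (hK : 1 ≤ K) {v : Fin K → ℝ} (hv : Antitone v) (hvpos : ∀ j, 0 < v j)
    {ε : ℝ} (hε : ε ∈ Set.Ioo (0 : ℝ) 1) {α β : ℝ} (hα : 0 < α) (hβ : 0 ≤ β) :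
    (diagonal v ε (diagAppeal K α β)).IsMMNL where
  v_nonneg j := (hvpos j).le
  v_antitone := hv
  a_nonneg i k := by
    simp only [diagonal, diagAppeal]
    split_ifs <;> linarith
  q_nonneg i k := by
    simp only [diagonal]
    split_ifs <;> linarith [hε.1, hε.2]
  q_le_one i k := by
    simp only [diagonal]
    split_ifs <;> linarith [hε.1, hε.2]
  w_pos k := by
    simp only [diagonal]
    have : (0 : ℝ) < K := by exact_mod_cast hK
    positivity
  w_sum := by
    have : (K : ℝ) ≠ 0 := by exact_mod_cast (by omega : K ≠ 0)
    simp [diagonal, this]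
  z_nonneg := le_rfl

/-- The diagonal entries of the quality matrix of `diagonal`. -/
def diagQuality (ε : ℝ) (i : Fin K) : ℝ := if i.val = 0 then 1 else 1 - ε

theorem diagQuality_pos {ε : ℝ} (hε : ε ∈ Set.Ioo (0 : ℝ) 1) (i : Fin K) :
    0 < diagQuality ε i := by
  unfold diagQuality
  split_ifs <;> linarith [hε.1, hε.2]

theorem diagQuality_le_one {ε : ℝ} (hε : ε ∈ Set.Ioo (0 : ℝ) 1) (i : Fin K) :
    diagQuality ε i ≤ 1 := by
  unfold diagQuality
  split_ifs <;> linarith [hε.1, hε.2]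

theorem le_diagQuality {ε : ℝ} (hε : ε ∈ Set.Ioo (0 : ℝ) 1) (i : Fin K) :
    1 - ε ≤ diagQuality ε i := by
  unfold diagQuality
  split_ifs <;> linarith [hε.1, hε.2]

theorem avgQuality_diagonal (v : Fin K → ℝ) (ε : ℝ) (a : Fin K → Fin K → ℝ) (i : Fin K) :
    (diagonal v ε a).avgQuality i = diagQuality ε i / K := by
  simp only [avgQuality, diagonal, diagQuality, mul_ite, mul_zero, Finset.sum_ite_eq,
    Finset.mem_univ, if_true]
  split_ifs <;> ring

theorem maxAvgQuality_diagonal (hK : 1 ≤ K) (v : Fin K → ℝ) {ε : ℝ}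
    (hε : ε ∈ Set.Ioo (0 : ℝ) 1) (a : Fin K → Fin K → ℝ) :
    (diagonal v ε a).maxAvgQuality = 1 / K := by
  have : Nonempty (Fin K) := ⟨⟨0, hK⟩⟩
  have hle : ∀ i, (diagonal v ε a).avgQuality i ≤ 1 / K := fun i => by
    rw [avgQuality_diagonal]
    gcongr
    exact diagQuality_le_one hε i
  refine le_antisymm (ciSup_le hle) ?_
  refine le_trans (le_of_eq ?_) (le_ciSup (f := (diagonal v ε a).avgQuality)
    ⟨1 / K, by rintro _ ⟨i, rfl⟩; exact hle i⟩ ⟨0, hK⟩)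
  simp [avgQuality_diagonal, diagQuality]

/-- Since `ε > 0`, no item ties with the best one, so nothing can be ranked above it; ties among the
others are harmless. -/
theorem visibility_le_of_isAvgQualityRanking {v : Fin K → ℝ} (hv : Antitone v) {ε : ℝ}
    (hε : 0 < ε) {a : Fin K → Fin K → ℝ} {σ : Equiv.Perm (Fin K)}
    (hσ : (diagonal v ε a).IsAvgQualityRanking σ) {o : Fin K} (ho : o.val = 0) (j : Fin K) :
    v (σ j) ≤ v (σ o) := by
  refine hv (not_lt.1 fun hlt => ?_)
  have hjo : j.val ≠ 0 := fun hj => by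
    rw [Fin.ext (hj.trans ho.symm)] at hlt
    exact lt_irrefl _ hlt
  have hKpos : (0 : ℝ) < K := by exact_mod_cast (by omega : 0 < K)
  have := hσ j o hlt
  rw [avgQuality_diagonal, avgQuality_diagonal, div_le_div_iff_of_pos_right hKpos] at this
  simp only [diagQuality, ho, hjo, if_true, if_false] at this
  linarith

theorem buyProb_diagonal (v : Fin K → ℝ) (ε : ℝ) (a : Fin K → Fin K → ℝ)
    (σ : Equiv.Perm (Fin K)) (d : Fin K → ℕ) (i : Fin K) :
    (diagonal v ε a).buyProb σ d i =
      diagQuality ε i / K * (v (σ i) * (a i i + d i) / ∑ j, v (σ j) * (a j i + d j)) := by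
  simp only [buyProb, tryProb, diagonal, diagQuality, mul_ite, mul_zero, Finset.sum_ite_eq,
    Finset.mem_univ, if_true, add_zero]
  split_ifs <;> ring

/-- The total attraction of all items for class `i` under diagonal appeals. -/
theorem sum_attraction_diagAppeal (u : Fin K → ℝ) (α β : ℝ) (d : Fin K → ℕ) (i : Fin K) :
    ∑ j, u j * (diagAppeal K α β j i + d j) =
      ∑ j, u j * d j + β * ∑ j, u j + (α - β) * u i := by
  have : ∀ j, u j * (diagAppeal K α β j i + d j) =
      u j * d j + β * u j + if j = i then (α - β) * u j else 0 := fun j => by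
    unfold diagAppeal
    split_ifs <;> ring
  simp only [this, Finset.sum_add_distrib, Finset.sum_ite_eq', Finset.mem_univ, if_true,
    Finset.mul_sum]

theorem diagAppeal_self (α β : ℝ) (i : Fin K) : diagAppeal K α β i i = α := if_pos rfl

end Market

namespace Market

variable {K : ℕ}

/-! ### The Gamma quotient -/

/-- Log-convexity of `Γ` between `y` and `y + 1`. -/
theorem _root_.Real.Gamma_add_le_Gamma_mul_rpow {y τ : ℝ} (hy : 0 < y) (hτ0 : 0 < τ)
    (hτ1 : τ < 1) : Real.Gamma (y + τ) ≤ Real.Gamma y * y ^ τ := by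
  have h := Real.Gamma_mul_add_mul_le_rpow_Gamma_mul_rpow_Gamma hy (add_pos hy one_pos)
    (sub_pos.2 hτ1) hτ0 (by ring)
  have hΓ := Real.Gamma_pos_of_pos hy
  rw [show (1 - τ) * y + τ * (y + 1) = y + τ by ring, Real.Gamma_add_one hy.ne',
    Real.mul_rpow hy.le hΓ.le, mul_comm (y ^ τ), ← mul_assoc, ← Real.rpow_add hΓ] at h
  simpa using h

/-- `x ^ s * Γ(y - τ) / Γ(y)`, which grows like `x ^ s / y ^ τ`. -/
noncomputable def powerRatio (s τ x y : ℝ) : ℝ :=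
  x ^ s * (Real.Gamma (y - τ) / Real.Gamma y)

theorem powerRatio_nonneg {s τ x y : ℝ} (hx : 0 ≤ x) (hτ : 0 < τ) (hy : τ < y) :
    0 ≤ powerRatio s τ x y :=
  mul_nonneg (Real.rpow_nonneg hx _) (div_nonneg (Real.Gamma_pos_of_pos (by linarith)).le
    (Real.Gamma_pos_of_pos (by linarith)).le)

/-- Bernoulli's inequality for the concave power `s ≤ 1`. -/
theorem powerRatio_add_one_left_le {s τ x y : ℝ} (hs0 : 0 ≤ s) (hs1 : s ≤ 1) (hx : 0 < x)
    (hτ : 0 < τ) (hy : τ < y) :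
    powerRatio s τ (x + 1) y ≤ powerRatio s τ x y * (1 + s / x) := by
  have h1 : (x + 1) ^ s ≤ x ^ s * (1 + s / x) := by
    have hb := rpow_one_add_le_one_add_mul_self (s := x⁻¹)
      (by linarith [inv_pos.2 hx]) hs0 hs1
    have hx1 : x + 1 = x * (1 + x⁻¹) := by field_simp
    rw [hx1, Real.mul_rpow hx.le (by positivity), div_eq_mul_inv]
    gcongr
  have h2 : 0 ≤ Real.Gamma (y - τ) / Real.Gamma y :=
    div_nonneg (Real.Gamma_pos_of_pos (by linarith)).le (Real.Gamma_pos_of_pos (by linarith)).le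
  unfold powerRatio
  calc _ ≤ x ^ s * (1 + s / x) * (Real.Gamma (y - τ) / Real.Gamma y) := by gcongr
    _ = _ := by ring

/-- The reason for the Gamma quotient: its decrement is exact. For the plain power, convexity gives
`(y + 1) ^ (-τ) ≥ y ^ (-τ) * (1 - τ / y)`, the wrong direction for a supermartingale. -/
theorem powerRatio_add_one_right {s τ x y : ℝ} (hτ : 0 < τ) (hy : τ < y) :
    powerRatio s τ x (y + 1) = powerRatio s τ x y * (1 - τ / y) := by
  have hy0 : 0 < y := hτ.trans hy
  have hyt : 0 < y - τ := sub_pos.2 hy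
  have hΓ := (Real.Gamma_pos_of_pos hy0).ne'
  unfold powerRatio
  rw [show y + 1 - τ = (y - τ) + 1 by ring, Real.Gamma_add_one hyt.ne',
    Real.Gamma_add_one hy0.ne']
  field_simp

theorem rpow_mul_rpow_neg_le_powerRatio {s τ x y : ℝ} (hx : 0 ≤ x) (hτ : 0 < τ) (hτ1 : τ < 1)
    (hy : τ < y) : x ^ s * y ^ (-τ) ≤ powerRatio s τ x y := by
  have hy0 : 0 < y := hτ.trans hy
  have hyt : 0 < y - τ := sub_pos.2 hy
  have h := Real.Gamma_add_le_Gamma_mul_rpow hyt hτ hτ1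
  rw [sub_add_cancel] at h
  refine mul_le_mul_of_nonneg_left ?_ (Real.rpow_nonneg hx _)
  rw [le_div_iff₀ (Real.Gamma_pos_of_pos hy0), Real.rpow_neg hy0.le,
    inv_mul_le_iff₀ (Real.rpow_pos_of_pos hy0 _)]
  have h2 : (y - τ) ^ τ ≤ y ^ τ := Real.rpow_le_rpow hyt.le (by linarith) hτ.le
  calc _ ≤ _ := h
    _ ≤ Real.Gamma (y - τ) * y ^ τ := by
      have := (Real.Gamma_pos_of_pos hyt).le
      gcongr
    _ = _ := mul_comm _ _

/-- A bound for the share `x / n` by the ratio `powerRatio`. -/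
theorem div_le_powerRatio_mul_rpow {s τ x y n : ℝ} (hs1 : s ≤ 1) (hx : 0 ≤ x) (hτ : 0 < τ)
    (hτ1 : τ < 1) (hy : τ < y) (hxn : x ≤ n) (hyn : y ≤ n) :
    x / n ≤ powerRatio s τ x y * n ^ (τ - s) := by
  have hy0 : 0 < y := hτ.trans hy
  have hn : 0 < n := hy0.trans_le hyn
  -- The share is at most 1, so an exponent `s ≤ 1` can only increase it.
  calc x / n ≤ (x / n) ^ s := by
        simpa using Real.rpow_le_rpow_of_exponent_ge_of_imp (by positivity)
          ((div_le_one hn).2 hxn) hs1 (fun _ h => by linarith)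
    _ = x ^ s * n ^ (-τ) * n ^ (τ - s) := by
        rw [mul_assoc, ← Real.rpow_add hn, Real.div_rpow hx hn.le, div_eq_mul_inv,
          ← Real.rpow_neg hn.le]
        congr 2
        ring
    _ ≤ x ^ s * y ^ (-τ) * n ^ (τ - s) := by
        have : n ^ (-τ) ≤ y ^ (-τ) :=
          Real.rpow_le_rpow_of_nonpos hy0 hyn (by linarith)
        gcongr
    _ ≤ _ := by
        gcongr
        exact rpow_mul_rpow_neg_le_powerRatio hx hτ hτ1 hy

/-! ### The supermartingale -/

/-- Only sales of `j` and `o` matter. The chance of each is proportional to `d j + α` or `d o + α`,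
which cancels the relative change `s / (d j + α)` or `τ / (d o + α)`. The choice of `τ` gives both
drifts the factor `(1 - ε) * s / K`, and what remains is a comparison of visibilities over
attractions. The condition `s ≤ α` keeps the Gamma argument positive even before the first sale of
`o`. -/
theorem transition_powerRatio_le {v : Fin K → ℝ} (hvpos : ∀ j, 0 < v j) {ε : ℝ}
    (hε : ε ∈ Set.Ioo (0 : ℝ) 1) {α β : ℝ} (hα : 0 < α) (hβ : 0 ≤ β)
    {σ : Equiv.Perm (Fin K)} {o j : Fin K} (ho : o.val = 0) (hoj : o ≠ j)
    (hv : v (σ j) ≤ v (σ o)) {s : ℝ} (hs0 : 0 < s) (hs1 : s ≤ 1) (hsα : s ≤ α) :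
    (diagonal v ε (diagAppeal K α β)).transition σ
        (fun d => powerRatio s ((1 - ε) * s) (d j + α) (d o + α)) ≤
      fun d => powerRatio s ((1 - ε) * s) (d j + α) (d o + α) := by
  intro d
  have hτ : 0 < (1 - ε) * s := mul_pos (by linarith [hε.2]) hs0
  have hτα : (1 - ε) * s < α := by nlinarith [hε.1]
  have hKpos : (0 : ℝ) < K := by exact_mod_cast (by omega : 0 < K)
  have hdo : (0 : ℝ) ≤ d o := Nat.cast_nonneg _
  have hdj : (0 : ℝ) ≤ d j := Nat.cast_nonneg _
  have hV : 0 ≤ ∑ i, v (σ i) * (d i : ℝ) :=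
    Finset.sum_nonneg fun i _ => mul_nonneg (hvpos _).le (Nat.cast_nonneg _)
  have hS : ∀ i, v (σ i) ≤ ∑ i, v (σ i) := fun i =>
    Finset.single_le_sum (f := fun i => v (σ i)) (fun i _ => (hvpos _).le) (Finset.mem_univ i)
  have hD : ∀ i, 0 < ∑ l, v (σ l) * (d l : ℝ) + β * ∑ l, v (σ l) + (α - β) * v (σ i) := fun i => by
    have h1 := mul_le_mul_of_nonneg_left (hS i) hβ
    have h2 := mul_pos hα (hvpos (σ i))
    linarith
  have hjo : j.val ≠ 0 := fun hj => hoj (Fin.ext (ho.trans hj.symm))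
  rw [transition_apply, Fintype.sum_eq_add o j hoj]
  · simp only [Pi.add_apply, Pi.single_eq_same, Pi.single_eq_of_ne hoj, Pi.single_eq_of_ne hoj.symm,
      add_zero, Nat.cast_add, Nat.cast_one]
    rw [add_right_comm (d o : ℝ), add_right_comm (d j : ℝ), powerRatio_add_one_right hτ (by linarith),
      buyProb_diagonal, buyProb_diagonal, sum_attraction_diagAppeal (fun i => v (σ i)),
      sum_attraction_diagAppeal (fun i => v (σ i)), diagAppeal_self, diagAppeal_self]
    simp only [diagQuality, ho, hjo, if_true, if_false]
    have hΦ := powerRatio_nonneg (s := s) (τ := (1 - ε) * s) (x := d j + α) (y := d o + α)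
      (by linarith) hτ (by linarith)
    have hstep := powerRatio_add_one_left_le (s := s) (τ := (1 - ε) * s) (x := d j + α)
      (y := d o + α) hs0.le hs1 (by linarith) hτ (by linarith)
    set Φ := powerRatio s ((1 - ε) * s) (d j + α) (d o + α)
    set V := ∑ l, v (σ l) * (d l : ℝ) + β * ∑ l, v (σ l) with hVdef
    have hDo := hD o
    have hDj := hD j
    have hε1 : 0 < 1 - ε := by linarith [hε.2]
    have hpj : 0 ≤ (1 - ε) / K * (v (σ j) * (α + d j) / (V + (α - β) * v (σ j))) := by
      have := hvpos (σ j)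
      positivity
    -- The map `t ↦ t / (V + (α - β) * t)` is nondecreasing where its denominator is positive,
    -- because `V ≥ 0`: the cross terms in `α - β` cancel.
    have hcross : v (σ j) / (V + (α - β) * v (σ j)) ≤ v (σ o) / (V + (α - β) * v (σ o)) := by
      rw [div_le_div_iff₀ hDj hDo]
      have : 0 ≤ V := add_nonneg hV (mul_nonneg hβ ((hvpos _).le.trans (hS o)))
      nlinarith
    have h1 := mul_le_mul_of_nonneg_left (sub_le_sub_right hstep Φ) hpj
    have h2 : (1 - ε) / K * (v (σ j) * (α + d j) / (V + (α - β) * v (σ j))) *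
        (Φ * (1 + s / (d j + α)) - Φ) =
        Φ * ((1 - ε) * s / K) * (v (σ j) / (V + (α - β) * v (σ j))) := by
      have : (d j : ℝ) + α ≠ 0 := by linarith
      rw [add_comm α]
      field_simp
      ring
    have h3 : 1 / K * (v (σ o) * (α + d o) / (V + (α - β) * v (σ o))) *
        (Φ * (1 - (1 - ε) * s / (d o + α)) - Φ) =
        -(Φ * ((1 - ε) * s / K) * (v (σ o) / (V + (α - β) * v (σ o)))) := by
      have : (d o : ℝ) + α ≠ 0 := by linarith
      rw [add_comm α]
      field_simp
      ring
    have h4 : Φ * ((1 - ε) * s / K) * (v (σ j) / (V + (α - β) * v (σ j))) ≤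
        Φ * ((1 - ε) * s / K) * (v (σ o) / (V + (α - β) * v (σ o))) := by
      gcongr
    linarith
  · rintro i ⟨hio, hij⟩
    simp [Pi.single_eq_of_ne hio.symm, Pi.single_eq_of_ne hij.symm]

/-! ### Growth of sales, and the error in terms of rival shares -/

/-- The total attraction is bounded below and above by multiples of the number of sales. -/
theorem sum_attraction_bounds {u : Fin K → ℝ} {c m α β : ℝ} (hc : 0 < c) (hcu : ∀ i, c ≤ u i)
    (hum : ∀ i, u i ≤ m) (hα : 0 < α) (hβ : 0 ≤ β) (d : Fin K → ℕ) (i : Fin K) :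
    c * (∑ l, (d l : ℝ) + α) ≤ ∑ j, u j * (diagAppeal K α β j i + d j) ∧
      ∑ j, u j * (diagAppeal K α β j i + d j) ≤
        (m + (β * ∑ j, u j + m * α) / α) * (∑ l, (d l : ℝ) + α) := by
  rw [sum_attraction_diagAppeal]
  have h1 : c * ∑ l, (d l : ℝ) ≤ ∑ l, u l * (d l : ℝ) := by
    rw [Finset.mul_sum]
    exact Finset.sum_le_sum fun l _ => mul_le_mul_of_nonneg_right (hcu l) (Nat.cast_nonneg _)
  have h2 : ∑ l, u l * (d l : ℝ) ≤ m * ∑ l, (d l : ℝ) := by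
    rw [Finset.mul_sum]
    exact Finset.sum_le_sum fun l _ => mul_le_mul_of_nonneg_right (hum l) (Nat.cast_nonneg _)
  have h3 : u i ≤ ∑ l, u l :=
    Finset.single_le_sum (fun l _ => (hc.trans_le (hcu l)).le) (Finset.mem_univ i)
  have h4 := mul_le_mul_of_nonneg_left h3 hβ
  have h5 := mul_le_mul_of_nonneg_left (hcu i) hα.le
  have h6 := mul_le_mul_of_nonneg_left (hum i) hα.le
  have hu : 0 < u i := hc.trans_le (hcu i)
  have hn : 0 ≤ ∑ l, (d l : ℝ) := Finset.sum_nonneg fun l _ => Nat.cast_nonneg _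
  have hm : 0 < m := hu.trans_le (hum i)
  refine ⟨by linarith, ?_⟩
  -- The upper constant is chosen so that its second part, multiplied by the summand `α`, pays for
  -- all terms that do not grow with sales.
  have h7 : (m + (β * ∑ j, u j + m * α) / α) * (∑ l, (d l : ℝ) + α) =
      m * ∑ l, (d l : ℝ) + m * α + (β * ∑ j, u j + m * α) / α * ∑ l, (d l : ℝ) +
        (β * ∑ j, u j + m * α) := by
    field_simp
    ring
  have h8 : 0 ≤ (β * ∑ j, u j + m * α) / α * ∑ l, (d l : ℝ) := by
    have : 0 ≤ ∑ j, u j := hu.le.trans h3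
    positivity
  have h9 := mul_nonneg hβ hu.le
  rw [h7]
  linarith [mul_pos hm hα]

theorem exists_pos_lower_bound {v : Fin K → ℝ} (hvpos : ∀ j, 0 < v j) :
    ∃ c, 0 < c ∧ ∀ j, c ≤ v j := by
  rcases isEmpty_or_nonempty (Fin K) with hK | hK
  · exact ⟨1, one_pos, fun j => hK.elim j⟩
  · obtain ⟨j, hj⟩ := Finite.exists_min v
    exact ⟨v j, hvpos j, hj⟩

theorem exists_pos_upper_bound (v : Fin K → ℝ) : ∃ m, 0 < m ∧ ∀ j, v j ≤ m := by
  rcases isEmpty_or_nonempty (Fin K) with hK | hK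
  · exact ⟨1, one_pos, fun j => hK.elim j⟩
  · obtain ⟨j, hj⟩ := Finite.exists_max v
    exact ⟨max 1 (v j), by positivity, fun i => (hj i).trans (le_max_right _ _)⟩

/-- The purchase probability is bounded away from zero. -/
theorem exists_le_sum_buyProb {v : Fin K → ℝ} (hK : 1 ≤ K) (hvpos : ∀ j, 0 < v j) {ε : ℝ}
    (hε : ε ∈ Set.Ioo (0 : ℝ) 1) {α β : ℝ} (hα : 0 < α) (hβ : 0 ≤ β) (σ : Equiv.Perm (Fin K)) :
    ∃ b, 0 < b ∧ ∀ d, b ≤ ∑ i, (diagonal v ε (diagAppeal K α β)).buyProb σ d i := by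
  obtain ⟨c, hc, hcv⟩ := exists_pos_lower_bound hvpos
  obtain ⟨m, hm, hvm⟩ := exists_pos_upper_bound v
  set B := m + (β * ∑ j, v (σ j) + m * α) / α
  have hB : 0 < B := by
    have : 0 ≤ ∑ j, v (σ j) := Finset.sum_nonneg fun j _ => (hvpos _).le
    positivity
  have hKpos : (0 : ℝ) < K := by exact_mod_cast hK
  have hε1 : 0 < 1 - ε := by linarith [hε.2]
  refine ⟨(1 - ε) / K * (c / B), by positivity, fun d => ?_⟩
  have hn : 0 ≤ ∑ l, (d l : ℝ) := Finset.sum_nonneg fun l _ => Nat.cast_nonneg _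
  have hterm : ∀ i, (1 - ε) / K * (c / B) * ((α + d i) / (∑ l, (d l : ℝ) + α)) ≤
      (diagonal v ε (diagAppeal K α β)).buyProb σ d i := fun i => by
    rw [buyProb_diagonal, diagAppeal_self, mul_assoc, div_mul_div_comm]
    have hb := sum_attraction_bounds hc (fun i => hcv (σ i)) (fun i => hvm (σ i)) hα hβ d i
    have h0 : 0 < ∑ j, v (σ j) * (diagAppeal K α β j i + d j) :=
      lt_of_lt_of_le (by positivity) hb.1
    gcongr
    · exact div_nonneg (diagQuality_pos hε i).le hKpos.le
    · exact le_diagQuality hε i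
    · exact mul_nonneg (hvpos _).le (by positivity)
    · exact hcv _
    · exact hb.2
  refine le_trans ?_ (Finset.sum_le_sum fun i _ => hterm i)
  rw [← Finset.mul_sum, ← Finset.sum_div]
  -- The shares sum to at least 1: their numerators add up to the total sales plus `K * α`, and `K ≥
  -- 1`.
  refine le_mul_of_one_le_right (by positivity) ((one_le_div (by positivity)).2 ?_)
  rw [Finset.sum_add_distrib, add_comm]
  gcongr
  simp only [Finset.sum_const, Finset.card_univ, Fintype.card_fin, nsmul_eq_mul]
  exact le_mul_of_one_le_left hα.le (by exact_mod_cast hK)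

/-- Every sale halves the function, and a sale has probability at least `b`. -/
theorem transition_two_inv_pow_le (M : Market K K) (σ : Equiv.Perm (Fin K)) {b : ℝ}
    (hb : ∀ d, b ≤ ∑ i, M.buyProb σ d i) :
    M.transition σ (fun d => (1 / 2 : ℝ) ^ ∑ l, d l) ≤
      (1 - b / 2) • fun d => (1 / 2 : ℝ) ^ ∑ l, d l := by
  intro d
  have h1 : ∀ i, ∑ l, (d + Pi.single i 1 : Fin K → ℕ) l = ∑ l, d l + 1 := fun i => by
    simp [Finset.sum_add_distrib]
  rw [transition_apply]
  simp only [h1, pow_succ, Pi.smul_apply, smul_eq_mul, ← Finset.sum_mul]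
  have := mul_le_mul_of_nonneg_right (hb d) (by positivity : (0 : ℝ) ≤ (1 / 2) ^ ∑ l, d l)
  linarith

/-- The distance of the purchase probability to `1 / K` is controlled by the shares of the items
other than the best one. -/
theorem exists_abs_sum_buyProb_sub_le {v : Fin K → ℝ} (hvpos : ∀ j, 0 < v j) {ε : ℝ}
    (hε : ε ∈ Set.Ioo (0 : ℝ) 1) {α β : ℝ} (hα : 0 < α) (hβ : 0 ≤ β) (σ : Equiv.Perm (Fin K))
    {o : Fin K} (ho : o.val = 0) :
    ∃ C, 0 ≤ C ∧ ∀ d, |∑ i, (diagonal v ε (diagAppeal K α β)).buyProb σ d i - 1 / K| ≤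
      C * ∑ j ∈ Finset.univ.erase o, ((d j + α) / (∑ l, (d l : ℝ) + α)) := by
  obtain ⟨c, hc, hcv⟩ := exists_pos_lower_bound hvpos
  obtain ⟨m, hm, hvm⟩ := exists_pos_upper_bound v
  have hKpos : (0 : ℝ) < K := by exact_mod_cast (by omega : 0 < K)
  refine ⟨1 / K * (m / c * (1 + β / α)), by positivity, fun d => ?_⟩
  have hn : 0 ≤ ∑ l, (d l : ℝ) := Finset.sum_nonneg fun l _ => Nat.cast_nonneg _
  have hnα : 0 < ∑ l, (d l : ℝ) + α := by positivity
  have hb := fun i =>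
    sum_attraction_bounds hc (fun i => hcv (σ i)) (fun i => hvm (σ i)) hα hβ d i
  have h0 : ∀ i, 0 < ∑ j, v (σ j) * (diagAppeal K α β j i + d j) := fun i =>
    lt_of_lt_of_le (by positivity) (hb i).1
  -- Class `o` fails to buy exactly when it tries a rival, since its quality for `o` is 1 and `z =
  -- 0`.
  have hbest : (diagonal v ε (diagAppeal K α β)).buyProb σ d o - 1 / K =
      -(1 / K * ∑ j ∈ Finset.univ.erase o, v (σ j) * (β + d j) /
        ∑ l, v (σ l) * (diagAppeal K α β l o + d l)) := by
    rw [buyProb_diagonal, ← Finset.sum_div]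
    have hsplit := Finset.add_sum_erase Finset.univ
      (fun j => v (σ j) * (diagAppeal K α β j o + d j)) (Finset.mem_univ o)
    have hoff : ∑ j ∈ Finset.univ.erase o, v (σ j) * (diagAppeal K α β j o + d j) =
        ∑ j ∈ Finset.univ.erase o, v (σ j) * (β + d j) :=
      Finset.sum_congr rfl fun j hj => by
        rw [diagAppeal, if_neg (Finset.ne_of_mem_erase hj)]
    rw [hoff] at hsplit
    have h0o := (h0 o).ne'
    simp only [diagQuality, ho, if_true] at hsplit ⊢
    rw [← hsplit] at h0o ⊢
    field_simp
    ring
  have hA : 0 ≤ 1 / K * ∑ j ∈ Finset.univ.erase o, v (σ j) * (β + d j) /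
        ∑ l, v (σ l) * (diagAppeal K α β l o + d l) := by
    refine mul_nonneg (by positivity) (Finset.sum_nonneg fun j _ => div_nonneg
      (mul_nonneg (hvpos _).le (by positivity)) (h0 o).le)
  have hA' : 1 / K * ∑ j ∈ Finset.univ.erase o, v (σ j) * (β + d j) /
        ∑ l, v (σ l) * (diagAppeal K α β l o + d l) ≤ 1 / K * (m / c * (1 + β / α)) *
      ∑ j ∈ Finset.univ.erase o, ((d j + α) / (∑ l, (d l : ℝ) + α)) := by
    rw [mul_assoc]
    refine mul_le_mul_of_nonneg_left ?_ (by positivity)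
    rw [Finset.mul_sum]
    refine Finset.sum_le_sum fun j _ => ?_
    calc _ ≤ m * ((1 + β / α) * (d j + α)) / (c * (∑ l, (d l : ℝ) + α)) := by
          have h1 : β + d j ≤ (1 + β / α) * (d j + α) := by
            have h2 : (1 + β / α) * (d j + α) = d j + α + β + β / α * d j := by
              field_simp
              ring
            have h3 : 0 ≤ β / α * d j := by positivity
            linarith
          have := hvm (σ j)
          have := (hb o).1
          gcongr
      _ = _ := by
          field_simp
  have hR : 0 ≤ ∑ j ∈ Finset.univ.erase o, (diagonal v ε (diagAppeal K α β)).buyProb σ d j :=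
    Finset.sum_nonneg fun j _ => by
      rw [buyProb_diagonal, diagAppeal_self]
      exact mul_nonneg (div_nonneg (diagQuality_pos hε j).le hKpos.le)
        (div_nonneg (mul_nonneg (hvpos _).le (by positivity)) (h0 j).le)
  have hR' : ∑ j ∈ Finset.univ.erase o, (diagonal v ε (diagAppeal K α β)).buyProb σ d j ≤
      1 / K * (m / c * (1 + β / α)) *
        ∑ j ∈ Finset.univ.erase o, ((d j + α) / (∑ l, (d l : ℝ) + α)) := by
    rw [Finset.mul_sum]
    refine Finset.sum_le_sum fun j _ => ?_
    rw [buyProb_diagonal, diagAppeal_self, mul_assoc]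
    have hq := diagQuality_le_one hε j
    have h1 : v (σ j) * (α + d j) / ∑ l, v (σ l) * (diagAppeal K α β l j + d l) ≤
        m * (α + d j) / (c * (∑ l, (d l : ℝ) + α)) := by
      have := hvm (σ j)
      have := (hb j).1
      gcongr
    have h2 : m * (α + d j) / (c * (∑ l, (d l : ℝ) + α)) ≤
        m / c * (1 + β / α) * ((d j + α) / (∑ l, (d l : ℝ) + α)) := by
      have h3 : m * (α + d j) / (c * (∑ l, (d l : ℝ) + α)) =
          m / c * 1 * ((d j + α) / (∑ l, (d l : ℝ) + α)) := by
        field_simp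
        ring
      have h4 : 0 ≤ β / α := by positivity
      rw [h3]
      gcongr
      linarith
    refine mul_le_mul (by gcongr) (h1.trans h2) (div_nonneg (mul_nonneg (hvpos _).le
      (by positivity)) (h0 j).le) (by positivity)
  -- The loss in class `o` and the sales of rivals enter with opposite signs, so the same bound for
  -- each suffices for the difference.
  rw [← Finset.add_sum_erase _ _ (Finset.mem_univ o), add_sub_right_comm, hbest, abs_le]
  constructor <;> linarith

/-! ### Convergence with the popularity signal -/

/-- With diagonal appeals the purchase probability of an average quality ranking with the
popularity signal tends to the highest average quality. -/
theorem hasSignalLimit_diagonal (hK : 1 ≤ K) {v : Fin K → ℝ} (hv : Antitone v)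
    (hvpos : ∀ j, 0 < v j) {ε : ℝ} (hε : ε ∈ Set.Ioo (0 : ℝ) 1) {α β : ℝ} (hα : 0 < α)
    (hβ : 0 ≤ β) (h : (diagonal v ε (diagAppeal K α β)).IsMMNL) {σ : Equiv.Perm (Fin K)}
    (hσ : (diagonal v ε (diagAppeal K α β)).IsAvgQualityRanking σ) :
    (diagonal v ε (diagAppeal K α β)).HasSignalLimit h σ
      (diagonal v ε (diagAppeal K α β)).maxAvgQuality := by
  rw [maxAvgQuality_diagonal hK v hε]
  have ho : ((⟨0, hK⟩ : Fin K)).val = 0 := rfl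
  set o : Fin K := ⟨0, hK⟩
  obtain ⟨b, hb0, hb⟩ := exists_le_sum_buyProb hK hvpos hε hα hβ σ
  obtain ⟨C, hC, hCd⟩ := exists_abs_sum_buyProb_sub_le hvpos hε hα hβ σ ho
  have hb1 : b ≤ 1 := (hb 0).trans (sum_buyProb_le_one h σ 0)
  set s := min 1 α
  have hs0 : 0 < s := lt_min one_pos hα
  have hs1 : s ≤ 1 := min_le_left _ _
  have hsα : s ≤ α := min_le_right _ _
  have hτ : 0 < (1 - ε) * s := mul_pos (by linarith [hε.2]) hs0
  have hτs : (1 - ε) * s < s := by nlinarith [hε.1]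
  let Φ : Fin K → (Fin K → ℕ) → ℝ := fun j d =>
    powerRatio s ((1 - ε) * s) (d j + α) (d o + α)
  have hΦ0 : ∀ j d, 0 ≤ Φ j d := fun j d =>
    powerRatio_nonneg (by positivity) hτ (by
      have : (0 : ℝ) ≤ d o := Nat.cast_nonneg _
      linarith)
  refine hasSignalLimit_of_lyapunov h σ (r := 1 - b / 2)
    (Φ := ∑ j ∈ Finset.univ.erase o, Φ j) (G := fun d => (1 / 2 : ℝ) ^ ∑ l, d l)
    (by linarith) (by linarith) ?_ ?_ (transition_two_inv_pow_le _ σ hb) ?_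
  · rw [Finset.sum_apply]
    exact Finset.sum_nonneg fun j _ => hΦ0 j 0
  · rw [map_sum]
    exact Finset.sum_le_sum fun j hj => transition_powerRatio_le hvpos hε hα hβ ho
      (Finset.ne_of_mem_erase hj).symm (visibility_le_of_isAvgQualityRanking hv hε.1 hσ ho j)
      hs0 hs1 hsα
  · intro η hη
    have htend : Tendsto (fun n : ℕ => ((n : ℝ) + α) ^ ((1 - ε) * s - s)) atTop (𝓝 0) := by
      have := (tendsto_rpow_neg_atTop (sub_pos.2 hτs)).comp
        (tendsto_atTop_add_const_right atTop α tendsto_natCast_atTop_atTop)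
      simpa only [neg_sub, Function.comp_def] using this
    obtain ⟨n₀, hn₀⟩ := eventually_atTop.1
      (htend.eventually_le_const (div_pos hη (by positivity : 0 < C + 1)))
    -- Up to `n₀` sales, a share is at most `1 ≤ 2 ^ n₀ * (1 / 2) ^ sales`; beyond, the
    -- supermartingale bound applies. The factor `K` covers the `K - 1` rivals.
    refine ⟨C * (K * 2 ^ n₀), by positivity, fun d => (hCd d).trans ?_⟩
    have hn : ∑ l, (d l : ℝ) = ((∑ l, d l : ℕ) : ℝ) := by push_cast; rfl
    have hle : ∀ j, (d j : ℝ) ≤ ∑ l, (d l : ℝ) := fun j =>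
      Finset.single_le_sum (f := fun l => (d l : ℝ)) (fun l _ => Nat.cast_nonneg _)
        (Finset.mem_univ j)
    have hdo : (0 : ℝ) ≤ d o := Nat.cast_nonneg _
    have hshare : ∀ j, (d j + α) / (∑ l, (d l : ℝ) + α) ≤
        η / (C + 1) * Φ j d + 2 ^ n₀ * (1 / 2 : ℝ) ^ ∑ l, d l := fun j => by
      have hΦj := hΦ0 j d
      rcases le_total n₀ (∑ l, d l) with hle₀ | hle₀
      · have h1 := div_le_powerRatio_mul_rpow (s := s) (τ := (1 - ε) * s) (x := d j + α)
          (y := d o + α) (n := ∑ l, (d l : ℝ) + α) hs1 (by positivity) hτ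
          (by linarith) (by linarith) (by linarith [hle j]) (by linarith [hle o])
        have h2 := hn₀ _ hle₀
        rw [← hn] at h2
        have h3 := mul_le_mul_of_nonneg_left h2 hΦj
        have h4 : (0 : ℝ) ≤ 2 ^ n₀ * (1 / 2 : ℝ) ^ ∑ l, d l := by positivity
        linarith
      · have h1 : (d j + α) / (∑ l, (d l : ℝ) + α) ≤ 1 :=
          div_le_one_of_le₀ (by linarith [hle j]) (by linarith [hle o])
        have h2 : (1 : ℝ) ≤ 2 ^ n₀ * (1 / 2 : ℝ) ^ ∑ l, d l := by
          rw [one_div, inv_pow, ← div_eq_mul_inv, one_le_div (by positivity)]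
          exact pow_le_pow_right₀ one_le_two hle₀
        have h3 : 0 ≤ η / (C + 1) * Φ j d := by positivity
        linarith
    calc C * ∑ j ∈ Finset.univ.erase o, ((d j + α) / (∑ l, (d l : ℝ) + α))
        ≤ C * ∑ j ∈ Finset.univ.erase o,
          (η / (C + 1) * Φ j d + 2 ^ n₀ * (1 / 2 : ℝ) ^ ∑ l, d l) := by
          gcongr with j
          exact hshare j
      _ = C / (C + 1) * (η * ∑ j ∈ Finset.univ.erase o, Φ j d) +
          C * ((K - 1) * 2 ^ n₀) * (1 / 2 : ℝ) ^ ∑ l, d l := by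
          rw [Finset.sum_add_distrib, ← Finset.mul_sum, Finset.sum_const,
            Finset.card_erase_of_mem (Finset.mem_univ o), Finset.card_univ, Fintype.card_fin,
            nsmul_eq_mul, Nat.cast_sub hK]
          push_cast
          ring
      _ ≤ 1 * (η * ∑ j ∈ Finset.univ.erase o, Φ j d) +
          C * (K * 2 ^ n₀) * (1 / 2 : ℝ) ^ ∑ l, d l := by
          have h1 : C / (C + 1) ≤ 1 := div_le_one_of_le₀ (by linarith) (by linarith)
          have h2 : 0 ≤ ∑ j ∈ Finset.univ.erase o, Φ j d :=
            Finset.sum_nonneg fun j _ => hΦ0 j d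
          gcongr
          linarith
      _ = _ := by
          rw [Finset.sum_apply, one_mul]

/-! ### The explicit ratio without the signal, and its limits -/

theorem noSignalPurchaseProb_diagonal (v : Fin K → ℝ) (ε α β : ℝ) (σ : Equiv.Perm (Fin K)) :
    (diagonal v ε (diagAppeal K α β)).noSignalPurchaseProb σ =
      1 / K * ∑ i, diagQuality ε i * (v (σ i) * α / (β * ∑ j, v j + (α - β) * v (σ i))) := by
  rw [noSignalPurchaseProb, Finset.mul_sum]
  refine Finset.sum_congr rfl fun i _ => ?_
  rw [buyProb_diagonal, sum_attraction_diagAppeal (fun i => v (σ i)), diagAppeal_self,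
    Equiv.sum_comp σ v]
  simp only [Pi.zero_apply, Nat.cast_zero, mul_zero, Finset.sum_const_zero, zero_add, add_zero]
  ring

theorem noSignalPurchaseProb_div_maxAvgQuality (hK : 1 ≤ K) (v : Fin K → ℝ) {ε : ℝ}
    (hε : ε ∈ Set.Ioo (0 : ℝ) 1) (α β : ℝ) (σ : Equiv.Perm (Fin K)) :
    (diagonal v ε (diagAppeal K α β)).noSignalPurchaseProb σ /
        (diagonal v ε (diagAppeal K α β)).maxAvgQuality =
      ∑ i, diagQuality ε i * (v (σ i) * α / (β * ∑ j, v j + (α - β) * v (σ i))) := by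
  have hKpos : (0 : ℝ) < K := by exact_mod_cast hK
  rw [maxAvgQuality_diagonal hK v hε, noSignalPurchaseProb_diagonal,
    mul_div_cancel_left₀ _ (by positivity)]

theorem tendsto_ratio_idAppeal (hK : 1 ≤ K) {v : Fin K → ℝ} (hvpos : ∀ j, 0 < v j)
    (σ : ℝ → Equiv.Perm (Fin K)) :
    Tendsto (fun ε : ℝ => (diagonal v ε (diagAppeal K 1 0)).noSignalPurchaseProb (σ ε) /
      (diagonal v ε (diagAppeal K 1 0)).maxAvgQuality) (𝓝[>] 0) (𝓝 (K : ℝ)) := by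
  have hlim : Tendsto (fun ε : ℝ => ∑ i : Fin K, diagQuality ε i) (𝓝[>] 0) (𝓝 (K : ℝ)) := by
    have hcont : Continuous fun ε : ℝ => ∑ i : Fin K, diagQuality ε i := by
      refine continuous_finsetSum _ fun i _ => ?_
      unfold diagQuality
      split_ifs <;> fun_prop
    have h0 : ∑ i : Fin K, diagQuality 0 i = (K : ℝ) := by simp [diagQuality]
    exact (h0 ▸ hcont.tendsto 0).mono_left nhdsWithin_le_nhds
  refine hlim.congr' ?_
  filter_upwards [Ioo_mem_nhdsGT one_pos] with ε hε
  rw [noSignalPurchaseProb_div_maxAvgQuality hK v hε]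
  refine Finset.sum_congr rfl fun i _ => ?_
  have := (hvpos (σ ε i)).ne'
  rw [zero_mul, sub_zero, one_mul, mul_one, zero_add, div_self this, mul_one]

/-- One parameter `ε` serves both as quality gap and as off-diagonal appeal. The lower bound uses
only the least visibility `c`, hence is uniform in the ranking. -/
theorem exists_forall_lt_ratio (hK : 1 ≤ K) {v : Fin K → ℝ} (hvpos : ∀ j, 0 < v j) {r : ℝ}
    (hr : r < K) : ∃ ε ∈ Set.Ioo (0 : ℝ) 1, ∀ σ : Equiv.Perm (Fin K),
      r < (diagonal v ε (diagAppeal K 1 ε)).noSignalPurchaseProb σ /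
        (diagonal v ε (diagAppeal K 1 ε)).maxAvgQuality := by
  obtain ⟨c, hc, hcv⟩ := exists_pos_lower_bound hvpos
  have hS : 0 ≤ ∑ j, v j := Finset.sum_nonneg fun j _ => (hvpos j).le
  have hlim : Tendsto (fun ε : ℝ => K * ((1 - ε) * (c / (c + ε * ∑ j, v j)))) (𝓝[>] 0)
      (𝓝 (K : ℝ)) := by
    have hcont : ContinuousAt (fun ε : ℝ => K * ((1 - ε) * (c / (c + ε * ∑ j, v j)))) 0 := by
      have : c + 0 * ∑ j, v j ≠ 0 := by simpa using hc.ne'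
      fun_prop (disch := assumption)
    have h0 : (K : ℝ) * ((1 - 0) * (c / (c + 0 * ∑ j, v j))) = K := by
      field_simp
      ring
    exact (h0 ▸ hcont.tendsto).mono_left nhdsWithin_le_nhds
  obtain ⟨ε, hrε, hε⟩ := ((hlim.eventually_const_lt hr).and (Ioo_mem_nhdsGT one_pos)).exists
  refine ⟨ε, hε, fun σ => hrε.trans_le ?_⟩
  have hε0 : 0 < ε := hε.1
  have hε1 : 0 < 1 - ε := by linarith [hε.2]
  rw [noSignalPurchaseProb_div_maxAvgQuality hK v hε]
  have : (K : ℝ) * ((1 - ε) * (c / (c + ε * ∑ j, v j))) =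
      ∑ _i : Fin K, (1 - ε) * (c / (c + ε * ∑ j, v j)) := by simp
  rw [this]
  refine Finset.sum_le_sum fun i _ => mul_le_mul (le_diagQuality hε i) ?_ (by positivity)
    (diagQuality_pos hε i).le
  have hvi := hvpos (σ i)
  have hD : 0 < ε * ∑ j, v j + (1 - ε) * v (σ i) := by positivity
  rw [mul_one, div_le_div_iff₀ (by positivity) hD]
  have h1 : 0 ≤ (v (σ i) - c) * (ε * ∑ j, v j) :=
    mul_nonneg (sub_nonneg.2 (hcv _)) (by positivity)
  have h2 : 0 ≤ c * (ε * v (σ i)) := by positivity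
  nlinarith

theorem tendsto_ratio_smallDiagAppeal (hK : 2 ≤ K) {v : Fin K → ℝ} (hvpos : ∀ j, 0 < v j)
    {ε : ℝ} (hε : ε ∈ Set.Ioo (0 : ℝ) 1) (σ : ℝ → Equiv.Perm (Fin K)) :
    Tendsto (fun α : ℝ => (diagonal v ε (diagAppeal K α 1)).noSignalPurchaseProb (σ α) /
      (diagonal v ε (diagAppeal K α 1)).maxAvgQuality) (𝓝[>] 0) (𝓝 0) := by
  obtain ⟨c, hc, hcv⟩ := exists_pos_lower_bound hvpos
  obtain ⟨m, hm, hvm⟩ := exists_pos_upper_bound v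
  -- Here `K ≥ 2` enters: a second item keeps the denominators away from 0 as the diagonal appeal
  -- vanishes.
  have hlt : ∀ i, c ≤ ∑ j, v j - v i := fun i => by
    have : Nontrivial (Fin K) := Fin.nontrivial_iff_two_le.2 hK
    obtain ⟨j, hj⟩ := exists_ne i
    rw [← Finset.add_sum_erase _ _ (Finset.mem_univ i), add_sub_cancel_left]
    exact (hcv j).trans (Finset.single_le_sum (fun l _ => (hvpos l).le)
      (Finset.mem_erase.2 ⟨hj, Finset.mem_univ j⟩))
  have hlim : Tendsto (fun α : ℝ => K * (m * α / c)) (𝓝[>] 0) (𝓝 0) := by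
    have hcont : Continuous fun α : ℝ => K * (m * α / c) := by fun_prop
    have h0 : (K : ℝ) * (m * 0 / c) = 0 := by simp
    exact (h0 ▸ hcont.tendsto 0).mono_left nhdsWithin_le_nhds
  have hD : ∀ α : ℝ, 0 < α → ∀ i, c ≤ 1 * ∑ j, v j + (α - 1) * v i := fun α hα i => by
    have := mul_pos hα (hvpos i)
    linarith [hlt i]
  refine tendsto_of_tendsto_of_tendsto_of_le_of_le' tendsto_const_nhds hlim ?_ ?_
  · filter_upwards [self_mem_nhdsWithin] with α (hα : 0 < α)
    rw [noSignalPurchaseProb_div_maxAvgQuality (by omega) v hε]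
    exact Finset.sum_nonneg fun i _ => mul_nonneg (diagQuality_pos hε i).le
      (div_nonneg (mul_nonneg (hvpos _).le hα.le) (hc.le.trans (hD α hα _)))
  · filter_upwards [self_mem_nhdsWithin] with α (hα : 0 < α)
    rw [noSignalPurchaseProb_div_maxAvgQuality (by omega) v hε]
    have : (K : ℝ) * (m * α / c) = ∑ _i : Fin K, 1 * (m * α / c) := by simp
    rw [this]
    refine Finset.sum_le_sum fun i _ => mul_le_mul (diagQuality_le_one hε i) ?_
      (div_nonneg (mul_nonneg (hvpos _).le hα.le) (hc.le.trans (hD α hα _))) zero_le_one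
    have := hvm (σ α i)
    have := hD α hα (σ α i)
    gcongr

theorem maxAvgQuality_diagonal_pos (hK : 1 ≤ K) (v : Fin K → ℝ) {ε : ℝ}
    (hε : ε ∈ Set.Ioo (0 : ℝ) 1) (a : Fin K → Fin K → ℝ) :
    0 < (diagonal v ε a).maxAvgQuality := by
  have hKpos : (0 : ℝ) < K := by exact_mod_cast hK
  rw [maxAvgQuality_diagonal hK v hε]
  positivity

theorem positiveAppeals_diagonal (v : Fin K → ℝ) (ε : ℝ) {α β : ℝ} (hα : 0 < α) (hβ : 0 < β) :
    (diagonal v ε (diagAppeal K α β)).PositiveAppeals := by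
  intro i k
  simp only [diagonal, diagAppeal]
  split_ifs <;> assumption

end Market

theorem mainTheorem6 (K : ℕ) (hK : 1 ≤ K) (v : Fin K → ℝ) (hv : Antitone v)
    (hvpos : ∀ j, 0 < v j) :
    -- upper bound `K`: identity appeals, `ε → 0`
    (∀ σ : ℝ → Equiv.Perm (Fin K),
      (∀ ε ∈ Set.Ioo (0 : ℝ) 1,
        (Market.diagonal v ε (Market.idAppeal K)).IsAvgQualityRanking (σ ε)) →
      (∀ ε ∈ Set.Ioo (0 : ℝ) 1,
        0 < (Market.diagonal v ε (Market.idAppeal K)).maxAvgQuality ∧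
        ∃ h : (Market.diagonal v ε (Market.idAppeal K)).IsMMNL,
          (Market.diagonal v ε (Market.idAppeal K)).HasSignalLimit h (σ ε)
            (Market.diagonal v ε (Market.idAppeal K)).maxAvgQuality) ∧
      Tendsto (fun ε : ℝ =>
          (Market.diagonal v ε (Market.idAppeal K)).noSignalPurchaseProb (σ ε) /
            (Market.diagonal v ε (Market.idAppeal K)).maxAvgQuality)
        (𝓝[>] 0) (𝓝 (K : ℝ))) ∧
    -- upper bound `K` within the models whose appeals are all strictly positive
    (∀ r : ℝ, r < K → ∃ ε ∈ Set.Ioo (0 : ℝ) 1, ∃ a : Fin K → Fin K → ℝ,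
      (Market.diagonal v ε a).PositiveAppeals ∧
      0 < (Market.diagonal v ε a).maxAvgQuality ∧
      ∃ h : (Market.diagonal v ε a).IsMMNL, ∀ σ : Equiv.Perm (Fin K),
        (Market.diagonal v ε a).IsAvgQualityRanking σ →
          (Market.diagonal v ε a).HasSignalLimit h σ (Market.diagonal v ε a).maxAvgQuality ∧
          r < (Market.diagonal v ε a).noSignalPurchaseProb σ /
            (Market.diagonal v ε a).maxAvgQuality) ∧
    -- lower bound `0`: small diagonal appeals `α → 0`
    (2 ≤ K → ∀ ε ∈ Set.Ioo (0 : ℝ) 1, ∀ σ : ℝ → Equiv.Perm (Fin K),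
      (∀ α : ℝ, 0 < α →
        (Market.diagonal v ε (Market.smallDiagAppeal K α)).IsAvgQualityRanking (σ α)) →
      (∀ α : ℝ, 0 < α →
        (Market.diagonal v ε (Market.smallDiagAppeal K α)).PositiveAppeals ∧
        0 < (Market.diagonal v ε (Market.smallDiagAppeal K α)).maxAvgQuality ∧
        ∃ h : (Market.diagonal v ε (Market.smallDiagAppeal K α)).IsMMNL,
          (Market.diagonal v ε (Market.smallDiagAppeal K α)).HasSignalLimit h (σ α)
            (Market.diagonal v ε (Market.smallDiagAppeal K α)).maxAvgQuality) ∧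
      Tendsto (fun α : ℝ =>
          (Market.diagonal v ε (Market.smallDiagAppeal K α)).noSignalPurchaseProb (σ α) /
            (Market.diagonal v ε (Market.smallDiagAppeal K α)).maxAvgQuality)
        (𝓝[>] 0) (𝓝 0)) := by
  -- `idAppeal K` and `smallDiagAppeal K α` unfold to `diagAppeal K 1 0` and `diagAppeal K α 1`, so
  -- the general lemmas apply by definitional equality.
  refine ⟨fun σ hσ => ⟨fun ε hε => ?_, Market.tendsto_ratio_idAppeal hK hvpos σ⟩,
    fun r hr => ?_, fun hK2 ε hε σ hσ => ⟨fun α hα => ?_,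
      Market.tendsto_ratio_smallDiagAppeal hK2 hvpos hε σ⟩⟩
  · have h := Market.isMMNL_diagonal hK hv hvpos hε one_pos (le_refl (0 : ℝ))
    exact ⟨Market.maxAvgQuality_diagonal_pos hK v hε _, h,
      Market.hasSignalLimit_diagonal hK hv hvpos hε one_pos le_rfl h (hσ ε hε)⟩
  · obtain ⟨ε, hε, hrε⟩ := Market.exists_forall_lt_ratio hK hvpos hr
    have h := Market.isMMNL_diagonal hK hv hvpos hε one_pos hε.1.le
    exact ⟨ε, hε, Market.diagAppeal K 1 ε,
      Market.positiveAppeals_diagonal v ε one_pos hε.1,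
      Market.maxAvgQuality_diagonal_pos hK v hε _, h, fun σ hσ =>
        ⟨Market.hasSignalLimit_diagonal hK hv hvpos hε one_pos hε.1.le h hσ, hrε σ⟩⟩
  · have h := Market.isMMNL_diagonal hK hv hvpos hε hα zero_le_one
    exact ⟨Market.positiveAppeals_diagonal v ε hα one_pos,
      Market.maxAvgQuality_diagonal_pos hK v hε _, h,
      Market.hasSignalLimit_diagonal hK hv hvpos hε hα zero_le_one h (hσ α hα)⟩
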